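/- Let $k\ge 1$ and let $M=\{p\in\mathbb R^{k+1} : p_1^2+p_2^2=1\}\cong \mathbb S^1\times\mathbb R^{k-1}$ be the hypercylinder (the cylinder in $\mathbb R^3$ if $k=2$) with the Riemannian metric induced from $\mathbb R^{k+1}$, and let $d$ be its intrinsic (geodesic) distance. Fix $0<\varepsilon<\pi$ and let $$\mathcal B_\varepsilon=\{(\cos x,\sin x,z) : x\in(0,\pi-\varepsilon),\ z\in\mathbb R^{k-1}\}\subset M .$$ Assume (H) $K:M\times M\to\mathbb R$ has the form $K(x,y)=g(d(x,y)^2)$, where $g:[0,\infty)\to\mathbb R$ is differentiable with locally Lipschitz continuous derivative. For a curve $\rho=(\rho_t)_{t\in[0,T)}$ of Borel probability measures on $\mathcal B_\varepsilon$ let $v[\rho](x,t)=-\int_{\mathcal B_\varepsilon}\nabla_M K_y(x)\,d\rho_t(y)$, where $K_y=K(\cdot,y)$. A flow map of $v[\rho]$ on $\operatorname{supp}(\rho_0)\times[0,T)$ is a map $\Psi:\operatorname{supp}(\rho_0)\times[0,T)\to\mathcal B_\varepsilon$, $(x,t)\mapsto\Psi^t(x)$, with $\Psi^0(x)=x$ and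 $\frac{d}{dt}\Psi^t(x)=v[\rho](\Psi^t(x),t)$ for all $x\in\operatorname{supp}(\rho_0)$ and $t\in[0,T)$ (one-sided derivative at $t=0$). The curve $\rho$ is a weak solution on $[0,T)$ of the aggregation equation $\partial_t\rho-\nabla_M\cdot(\rho\,\nabla_M K*\rho)=0$ if $v[\rho]$ generates a unique flow map $\Psi$ on $\operatorname{supp}(\rho_0)\times[0,T)$ and $\rho_t$ is the push-forward $\Psi^t\#\rho_0$ for all $t\in[0,T)$. For compact $Q\subset\mathcal B_\varepsilon$ let $\mathcal P(Q)$ be the set of Borel probability measures on $\mathcal B_\varepsilon$ supported within $Q$, and let $C([0,T);\mathcal P(Q))$ be the set of curves $[0,T)\to\mathcal P(Q)$ that are continuous for the narrow topology. **Theorem (well-posedness on the open half-cylinder).** Assume (H) and let $\rho_0$ be a Borel probability measure on $\mathcal B_\varepsilon$ with compact support in $\mathcal B_\varepsilon$. Then there exist a time $T>0$ and a compact set $Q$ with $\operatorname{supp}(\rho_0)\subset Q\subset\mathcal B_\varepsilon$ such that there is exactly one curve in $C([0,T);\mathcal P(Q))$ that starts from $\rho_0$ at $t=0$ and is a weak solution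 on $[0,T)$. -/

import Mathlib

open MeasureTheory Set

noncomputable section

/-- The ambient Euclidean space of the `(n + 1)`-dimensional hypercylinder; the first two
coordinates carry the circle factor, the remaining `n` carry the factor `ℝⁿ`. -/
abbrev Ambient (n : ℕ) : Type := EuclideanSpace ℝ (Fin (n + 2))

/-- The hypercylinder `S¹ × ℝⁿ`, canonically embedded in `ℝ^(n+2)`. -/
def Hypercylinder (n : ℕ) : Set (Ambient n) :=
  {p | p 0 ^ 2 + p 1 ^ 2 = 1}

/-- The wrapping parametrization `(x, z) ↦ (cos x, sin x, z)`. -/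
def wrap {n : ℕ} (x : ℝ) (z : EuclideanSpace ℝ (Fin n)) : Ambient n :=
  WithLp.toLp 2 (Fin.cons (Real.cos x) (Fin.cons (Real.sin x) z.ofLp))

/-- The open band `{(cos x, sin x, z) | 0 < x < π - ε, z ∈ ℝⁿ}` of the hypercylinder. -/
def band (n : ℕ) (ε : ℝ) : Set (Ambient n) :=
  {p | ∃ x ∈ Ioo 0 (Real.pi - ε), ∃ z : EuclideanSpace ℝ (Fin n), p = wrap x z}

/-- The intrinsic (geodesic) distance of the hypercylinder with the metric induced from
`ℝ^(n+2)`: the infimum of the lengths of the `C¹` curves in the hypercylinder that join the two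
points. -/
def intrinsicDist {n : ℕ} (p q : Ambient n) : ℝ :=
  sInf {ℓ | ∃ γ : ℝ → Ambient n, ContDiffOn ℝ 1 γ (Icc 0 1) ∧
    (∀ s ∈ Icc (0 : ℝ) 1, γ s ∈ Hypercylinder n) ∧ γ 0 = p ∧ γ 1 = q ∧
    ℓ = ∫ s in (0 : ℝ)..1, ‖derivWithin γ (Icc 0 1) s‖}

/-- The tangent space of the hypercylinder at `p`, as a subspace of the ambient space. -/
def tangentAt {n : ℕ} (p : Ambient n) : Submodule ℝ (Ambient n) where
  carrier := {v | p 0 * v 0 + p 1 * v 1 = 0}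
  add_mem' {v w} hv hw := by
    simp only [mem_ofPred_eq, PiLp.add_apply] at hv hw ⊢
    linarith
  zero_mem' := by simp
  smul_mem' c v hv := by
    simp only [mem_ofPred_eq, PiLp.smul_apply, smul_eq_mul] at hv ⊢
    linear_combination c * hv

/-- The Riemannian gradient at `p` of a function on the hypercylinder (only the values of `f` on
the hypercylinder matter): the tangential part of the vector representing the differential of `f`
along the hypercylinder. -/
def surfaceGradient {n : ℕ} (f : Ambient n → ℝ) (p : Ambient n) : Ambient n :=
  (tangentAt p).starProjection (gradientWithin f (Hypercylinder n) p)

/-- Hypothesis (H) on the interaction potential: on the hypercylinder `K(x, y) = g(d(x, y)²)`,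
where `g : [0, ∞) → ℝ` is differentiable with locally Lipschitz continuous derivative. -/
def HypothesisH {n : ℕ} (K : Ambient n → Ambient n → ℝ) : Prop :=
  ∃ g : ℝ → ℝ, DifferentiableOn ℝ g (Ici 0) ∧
    LocallyLipschitzOn (Ici 0) (derivWithin g (Ici 0)) ∧
    ∀ x ∈ Hypercylinder n, ∀ y ∈ Hypercylinder n, K x y = g (intrinsicDist x y ^ 2)

/-- The Borel probability measures on the band that are supported within `Q`, with the narrow
topology. -/
abbrev ProbOn {n : ℕ} {ε : ℝ} (Q : Set (band n ε)) : Type :=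
  {μ : ProbabilityMeasure (band n ε) // (μ : Measure (band n ε)).support ⊆ Q}

/-- The velocity field `v[ρ](x, t) = - ∫ ∇K_y(x) dρ_t(y)`, where `K_y = K(·, y)`. -/
def velocity {n : ℕ} {ε T : ℝ} (K : Ambient n → Ambient n → ℝ)
    (ρ : Ico 0 T → ProbabilityMeasure (band n ε)) (x : band n ε) (t : Ico 0 T) : Ambient n :=
  -∫ y : band n ε, surfaceGradient (fun p => K p y) x ∂(ρ t : Measure (band n ε))

/-- `Ψ` is a flow map on `S × [0, T)`, with values in the band, of the time-dependent vector field
`X`; only the values `Ψ t x` with `0 ≤ t < T` and `x ∈ S` matter. -/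
def IsFlowMap {n : ℕ} {ε T : ℝ} (X : band n ε → Ico 0 T → Ambient n) (S : Set (band n ε))
    (Ψ : ℝ → band n ε → band n ε) : Prop :=
  ∀ x ∈ S, Ψ 0 x = x ∧ ∀ t : Ico 0 T,
    HasDerivWithinAt (fun s : ℝ => (Ψ s x : Ambient n)) (X (Ψ t x) t) (Ico 0 T) t

/-- Weak solution on `[0, T)` that starts from `ρ₀`: the velocity field `v[ρ]` generates a unique
flow map `Ψ` on `supp ρ₀ × [0, T)`, and `ρ_t` is the push-forward of `ρ₀` through `Ψ t` for all
`t`. -/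
def IsWeakSolution {n : ℕ} {ε T : ℝ} (K : Ambient n → Ambient n → ℝ)
    (ρ₀ : ProbabilityMeasure (band n ε)) (ρ : Ico 0 T → ProbabilityMeasure (band n ε)) : Prop :=
  ∃ Ψ : ℝ → band n ε → band n ε,
    IsFlowMap (velocity K ρ) (ρ₀ : Measure (band n ε)).support Ψ ∧
    (∀ Φ : ℝ → band n ε → band n ε,
      IsFlowMap (velocity K ρ) (ρ₀ : Measure (band n ε)).support Φ →
      ∀ x ∈ (ρ₀ : Measure (band n ε)).support, ∀ t ∈ Ico 0 T, Φ t x = Ψ t x) ∧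
    ∀ t : Ico 0 T, AEMeasurable (Ψ t) (ρ₀ : Measure (band n ε)) ∧
      (ρ t : Measure (band n ε)) = Measure.map (Ψ t) (ρ₀ : Measure (band n ε))

end

/-! Two points of the band differ in angle by less than `π`, so their geodesic distance is the
Euclidean distance of the unwrapped coordinates `(x, z)` (`intrinsicDist_wrap`): a `C¹` curve in the
hypercylinder lifts to a flat curve of the same speed. Hence `-∇K_y` becomes, in the orthonormal
frame at the point, the force `F(w) = -2 g'(|w|²) w` evaluated at the difference of the coordinates
(`surfaceGradient_potential`). This `F` is locally Lipschitz, and the problem turns into a flat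
aggregation equation on an open strip.

Existence is Lagrangian. The flow solves `∂ₜΦ(y) = ∫ F(Φ(y) - Φ(y')) dρ₀(y')`, an autonomous ODE in
the Banach space of continuous maps on the compact `supp ρ₀`. Picard–Lindelöf gives a solution that
stays within distance `r` of the initial map (`exists_lagrangian_flow`). For `r` small, the
trajectories remain in a compact subset `Q` of the band, and `ρ_t` is the push-forward.

Uniqueness is a Grönwall argument for all characteristics at once (`eq_of_norm_velocity_sub_le`).
Two solutions supported in `Q` have almost all their trajectories in `Q`, where one Lipschitz
constant of `F` controls both the moving point and the moving measure (`isWeakSolution_unique`). -/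

noncomputable section

/-! ### Flat coordinates and the geodesic distance -/

/-- The projection of the ambient space onto the `ℝⁿ` factor. -/
def tailL (n : ℕ) : Ambient n →L[ℝ] EuclideanSpace ℝ (Fin n) :=
  LinearMap.toContinuousLinearMap
    { toFun := fun p => WithLp.toLp 2 fun i => p i.succ.succ
      map_add' := fun p q => by ext i; simp
      map_smul' := fun a p => by ext i; simp }

/-- The inclusion of the `ℝⁿ` factor into the ambient space. -/
def padL (n : ℕ) : EuclideanSpace ℝ (Fin n) →L[ℝ] Ambient n :=
  LinearMap.toContinuousLinearMap
    { toFun := fun z => WithLp.toLp 2 (Fin.cons 0 (Fin.cons 0 z.ofLp))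
      map_add' := fun p q => by
        ext i
        refine Fin.cases ?_ (fun i => Fin.cases ?_ (fun i => ?_) i) i <;> simp
      map_smul' := fun a p => by
        ext i
        refine Fin.cases ?_ (fun i => Fin.cases ?_ (fun i => ?_) i) i <;> simp }

/-- The coordinate functions of the ambient space. -/
abbrev coordL (n : ℕ) (i : Fin (n + 2)) : Ambient n →L[ℝ] ℝ := EuclideanSpace.proj i

variable {n : ℕ}

@[simp] lemma tailL_apply (p : Ambient n) (i : Fin n) : tailL n p i = p i.succ.succ := rfl
@[simp] lemma padL_zero (z : EuclideanSpace ℝ (Fin n)) : padL n z 0 = 0 := rfl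
@[simp] lemma padL_one (z : EuclideanSpace ℝ (Fin n)) : padL n z 1 = 0 := rfl
@[simp] lemma tailL_padL (z : EuclideanSpace ℝ (Fin n)) : tailL n (padL n z) = z := rfl
@[simp] lemma wrap_zero (x : ℝ) (z : EuclideanSpace ℝ (Fin n)) : wrap x z 0 = Real.cos x := rfl
@[simp] lemma wrap_one (x : ℝ) (z : EuclideanSpace ℝ (Fin n)) : wrap x z 1 = Real.sin x := rfl
@[simp] lemma tailL_wrap (x : ℝ) (z : EuclideanSpace ℝ (Fin n)) : tailL n (wrap x z) = z := rfl

lemma ambient_ext {p q : Ambient n} (h0 : p 0 = q 0) (h1 : p 1 = q 1)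
    (ht : tailL n p = tailL n q) : p = q := by
  ext i
  refine Fin.cases h0 (fun i => Fin.cases h1 (fun i => ?_) i) i
  exact congrArg (fun z : EuclideanSpace ℝ (Fin n) => z i) ht

lemma ambient_inner (p q : Ambient n) :
    inner ℝ p q = p 0 * q 0 + p 1 * q 1 + inner ℝ (tailL n p) (tailL n q) := by
  simp only [PiLp.inner_apply, Fin.sum_univ_succ, tailL_apply, ← add_assoc]
  simp [mul_comm]

lemma ambient_norm_sq (p : Ambient n) : ‖p‖ ^ 2 = p 0 ^ 2 + p 1 ^ 2 + ‖tailL n p‖ ^ 2 := by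
  rw [← real_inner_self_eq_norm_sq, ← real_inner_self_eq_norm_sq, ambient_inner]
  ring

/-- The coordinate vectors of the ambient space. -/
abbrev axis (n : ℕ) (i : Fin (n + 2)) : Ambient n := EuclideanSpace.single i 1

@[simp] lemma tailL_axis_zero : tailL n (axis n 0) = 0 := by
  ext i; simp [axis]
@[simp] lemma tailL_axis_one : tailL n (axis n 1) = 0 := by
  ext i
  have : (i.succ.succ : Fin (n + 2)) ≠ 1 := fun h => by simp [Fin.ext_iff] at h
  simp [axis, this]

lemma wrap_eq (x : ℝ) (z : EuclideanSpace ℝ (Fin n)) :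
    wrap x z = Real.cos x • axis n 0 + Real.sin x • axis n 1 + padL n z := by
  apply ambient_ext <;> simp

lemma wrap_mem_hypercylinder (x : ℝ) (z : EuclideanSpace ℝ (Fin n)) :
    wrap x z ∈ Hypercylinder n := by
  simp [Hypercylinder]

/-- The vector of the frame at the angle `x` with angular part `a` and axial part `b`. -/
def frame (x : ℝ) : ℝ × EuclideanSpace ℝ (Fin n) →L[ℝ] Ambient n :=
  (ContinuousLinearMap.fst ℝ ℝ _).smulRight (-Real.sin x • axis n 0 + Real.cos x • axis n 1) +
    padL n ∘L ContinuousLinearMap.snd ℝ ℝ _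

lemma frame_apply (x : ℝ) (w : ℝ × EuclideanSpace ℝ (Fin n)) :
    frame x w = w.1 • (-Real.sin x • axis n 0 + Real.cos x • axis n 1) + padL n w.2 := rfl
@[simp] lemma frame_zero (x : ℝ) (w : ℝ × EuclideanSpace ℝ (Fin n)) :
    frame x w 0 = -Real.sin x * w.1 := by simp [frame_apply, mul_comm]
@[simp] lemma frame_one (x : ℝ) (w : ℝ × EuclideanSpace ℝ (Fin n)) :
    frame x w 1 = Real.cos x * w.1 := by simp [frame_apply, mul_comm]
@[simp] lemma tailL_frame (x : ℝ) (w : ℝ × EuclideanSpace ℝ (Fin n)) :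
    tailL n (frame x w) = w.2 := by simp [frame_apply]

lemma norm_frame_sq (x : ℝ) (w : ℝ × EuclideanSpace ℝ (Fin n)) :
    ‖frame x w‖ ^ 2 = w.1 ^ 2 + ‖w.2‖ ^ 2 := by
  rw [ambient_norm_sq]
  simp only [frame_zero, frame_one, tailL_frame]
  linear_combination w.1 ^ 2 * Real.sin_sq_add_cos_sq x

lemma hasFDerivAt_wrap (u : ℝ × EuclideanSpace ℝ (Fin n)) :
    HasFDerivAt (fun u : ℝ × EuclideanSpace ℝ (Fin n) => wrap u.1 u.2) (frame u.1) u := by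
  simp only [wrap_eq]
  have h1 := (hasFDerivAt_fst (𝕜 := ℝ) (p := u)).cos.smul_const (axis n 0)
  have h2 := (hasFDerivAt_fst (𝕜 := ℝ) (p := u)).sin.smul_const (axis n 1)
  have h3 := (padL n).hasFDerivAt.comp u (hasFDerivAt_snd (𝕜 := ℝ) (p := u))
  refine ((h1.add h2).add h3).congr_fderiv ?_
  ext1 <;> refine ContinuousLinearMap.ext fun w => ?_
  · apply ambient_ext <;> simp [frame_apply, mul_comm]
  · apply ambient_ext <;> simp [frame_apply]

lemma continuous_frame : Continuous (frame : ℝ → ℝ × EuclideanSpace ℝ (Fin n) →L[ℝ] Ambient n) := by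
  unfold frame
  refine Continuous.add ?_ continuous_const
  exact (ContinuousLinearMap.smulRightL ℝ _ _ _).continuous.comp
    (by fun_prop : Continuous fun x : ℝ => -Real.sin x • axis n 0 + Real.cos x • axis n 1)

/-- A `C¹` curve in the hypercylinder has an angle function: the angular speed integrates to a
determination of the angle. -/
lemma exists_angle_lift {γ : ℝ → Ambient n} (hγ : ContDiffOn ℝ 1 γ (Icc 0 1))
    (hM : ∀ s ∈ Icc (0 : ℝ) 1, γ s ∈ Hypercylinder n) (x : ℝ) :
    ∃ θ k : ℝ → ℝ, θ 0 = x ∧ Continuous k ∧ (∀ s, HasDerivAt θ (k s) s) ∧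
      (∀ s ∈ Icc (0 : ℝ) 1, ‖derivWithin γ (Icc 0 1) s‖ ^ 2 =
        k s ^ 2 + ‖tailL n (derivWithin γ (Icc 0 1) s)‖ ^ 2) ∧
      (γ 0 0 = Real.cos x → γ 0 1 = Real.sin x →
        γ 1 0 * Real.cos (θ 1) + γ 1 1 * Real.sin (θ 1) = 1) := by
  set γ' := derivWithin γ (Icc 0 1) with hγ'
  have hU : UniqueDiffOn ℝ (Icc (0 : ℝ) 1) := uniqueDiffOn_Icc_zero_one
  have hd : ∀ s ∈ Icc (0 : ℝ) 1, HasDerivWithinAt γ (γ' s) (Icc 0 1) s := fun s hs =>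
    (hγ.differentiableOn one_ne_zero s hs).hasDerivWithinAt
  have hc : ContinuousOn γ' (Icc 0 1) := hγ.continuousOn_derivWithin hU le_rfl
  have hi : ∀ i, ∀ s ∈ Icc (0 : ℝ) 1, HasDerivWithinAt (fun s => γ s i) (γ' s i) (Icc 0 1) s :=
    fun i s hs => (coordL n i).hasFDerivAt.comp_hasDerivWithinAt s (hd s hs)
  have hci : ∀ i, ContinuousOn (fun s => γ' s i) (Icc 0 1) := fun i =>
    (coordL n i).continuous.comp_continuousOn hc
  have hcγ : ∀ i, ContinuousOn (fun s => γ s i) (Icc 0 1) := fun i s hs =>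
    (hi i s hs).continuousWithinAt
  have horth : ∀ s ∈ Icc (0 : ℝ) 1, γ s 0 * γ' s 0 + γ s 1 * γ' s 1 = 0 := by
    intro s hs
    have h1 := ((hi 0 s hs).fun_pow 2).fun_add ((hi 1 s hs).fun_pow 2)
    have h2 : HasDerivWithinAt (fun s => γ s 0 ^ 2 + γ s 1 ^ 2) 0 (Icc 0 1) s :=
      (hasDerivWithinAt_const s _ (1 : ℝ)).congr_of_mem (fun r hr => hM r hr) hs
    have := (hU s hs).eq_deriv _ h1 h2
    norm_num at this
    linarith
  set k₀ : ℝ → ℝ := fun s => γ s 0 * γ' s 1 - γ s 1 * γ' s 0 with hk₀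
  have hk₀c : ContinuousOn k₀ (Icc 0 1) := ((hcγ 0).mul (hci 1)).sub ((hcγ 1).mul (hci 0))
  -- Extending the angular speed by its end values makes its primitive differentiable on the whole
  -- line, end points included.
  set k : ℝ → ℝ := IccExtend zero_le_one ((Icc (0 : ℝ) 1).domRestrict k₀) with hk
  have hkc : Continuous k := (continuousOn_iff_continuous_domRestrict.1 hk₀c).Icc_extend'
  have hkk : ∀ s ∈ Icc (0 : ℝ) 1, k s = k₀ s := fun s hs => by
    rw [hk, IccExtend_of_mem _ _ hs]; rfl
  have hθ : ∀ s, HasDerivAt (fun s => x + ∫ r in (0 : ℝ)..s, k r) (k s) s := fun s =>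
    (hkc.integral_hasStrictDerivAt 0 s).hasDerivAt.const_add x
  refine ⟨fun s => x + ∫ r in (0 : ℝ)..s, k r, k, by simp, hkc, hθ, ?_, ?_⟩
  · intro s hs
    rw [ambient_norm_sq, hkk s hs]
    -- Lagrange's identity: the circle part of `γ` is a unit vector orthogonal to that of `γ'`, so
    -- the latter has squared norm `k₀²`.
    have h1 : γ s 0 ^ 2 + γ s 1 ^ 2 = 1 := hM s hs
    have h2 := horth s hs
    simp only [hk₀, add_left_inj]
    linear_combination (-(γ' s 0) ^ 2 - (γ' s 1) ^ 2) * h1 +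
      (γ s 0 * γ' s 0 + γ s 1 * γ' s 1) * h2
  · intro h0 h1
    set θ : ℝ → ℝ := fun s => x + ∫ r in (0 : ℝ)..s, k r with hθdef
    -- The inner product of the circle part of `γ` with `(cos θ, sin θ)` is constant, as both
    -- vectors rotate with angular speed `k`; it equals `1` at the start.
    have hP : ∀ s ∈ Icc (0 : ℝ) 1, HasDerivWithinAt
        (fun s => γ s 0 * Real.cos (θ s) + γ s 1 * Real.sin (θ s)) 0 (Icc 0 1) s := by
      intro s hs
      have hc := (hθ s).cos.hasDerivWithinAt (s := Icc 0 1)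
      have hs' := (hθ s).sin.hasDerivWithinAt (s := Icc 0 1)
      refine (((hi 0 s hs).fun_mul hc).fun_add ((hi 1 s hs).fun_mul hs')).congr_deriv ?_
      have e1 : γ s 0 ^ 2 + γ s 1 ^ 2 = 1 := hM s hs
      have e2 := horth s hs
      rw [hkk s hs]
      simp only [hk₀]
      have e3 : γ' s 0 = -(γ s 0 * γ' s 1 - γ s 1 * γ' s 0) * γ s 1 := by
        linear_combination -(γ' s 0) * e1 + γ s 0 * e2
      have e4 : γ' s 1 = (γ s 0 * γ' s 1 - γ s 1 * γ' s 0) * γ s 0 := by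
        linear_combination -(γ' s 1) * e1 + γ s 1 * e2
      change γ' s 0 * Real.cos (θ s) + _ + (γ' s 1 * Real.sin (θ s) + _) = 0
      linear_combination Real.cos (θ s) * e3 + Real.sin (θ s) * e4
    have hconst := constant_of_derivWithin_zero
      (fun s hs => (hP s hs).differentiableWithinAt)
      (fun s hs => (hP s (Ico_subset_Icc_self hs)).derivWithin (hU s (Ico_subset_Icc_self hs)))
      1 (right_mem_Icc.2 zero_le_one)
    simp only at hconst
    rw [hconst]
    have : θ 0 = x := by simp [hθdef]
    rw [this, h0, h1]
    linear_combination Real.sin_sq_add_cos_sq x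

/-- The numbers differ by a multiple of `2π`, and a representative in `[-π, π]` has the least
absolute value. It bounds below the total rotation of a curve by the angular difference of its end
points. -/
lemma abs_le_abs_of_cos_sub_eq_one {a b : ℝ} (hb : |b| ≤ Real.pi) (h : Real.cos (b - a) = 1) :
    |b| ≤ |a| := by
  obtain ⟨m, hm⟩ := (Real.cos_eq_one_iff _).1 h
  rcases eq_or_ne m 0 with rfl | hm0
  · have : b = a := by simp at hm; linarith
    rw [this]
  · have h1 : (1 : ℝ) ≤ |(m : ℝ)| := by exact_mod_cast Int.one_le_abs hm0
    have h2 : 2 * Real.pi ≤ |b - a| := by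
      rw [← hm, abs_mul, abs_of_pos Real.two_pi_pos]
      nlinarith [Real.pi_pos]
    have := abs_sub b a
    linarith

/-- For an angular difference at most `π` the unwrapped segment is a shortest curve. -/
lemma intrinsicDist_wrap {x x' : ℝ} (h : |x' - x| ≤ Real.pi) (z z' : EuclideanSpace ℝ (Fin n)) :
    intrinsicDist (wrap x z) (wrap x' z') = √((x - x') ^ 2 + ‖z - z'‖ ^ 2) := by
  apply IsLeast.csInf_eq
  constructor
  · set v : ℝ × EuclideanSpace ℝ (Fin n) := (x' - x, z' - z) with hv
    set c : ℝ → ℝ × EuclideanSpace ℝ (Fin n) := fun s => (x, z) + s • v with hc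
    have hcd : ∀ s, HasDerivAt c v s := fun s => by
      simpa [hc] using ((hasDerivAt_id s).smul_const v).const_add (x, z)
    have hd : ∀ s, HasDerivAt (fun s => wrap (c s).1 (c s).2) (frame (c s).1 v) s := fun s =>
      (hasFDerivAt_wrap (c s)).comp_hasDerivAt s (hcd s)
    refine ⟨fun s => wrap (c s).1 (c s).2, ?_, fun s _ => wrap_mem_hypercylinder _ _, ?_, ?_, ?_⟩
    · refine (contDiff_one_iff_deriv.2 ⟨fun s => (hd s).differentiableAt, ?_⟩).contDiffOn
      rw [funext fun s => (hd s).deriv]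
      exact (continuous_frame.comp (by fun_prop)).clm_apply continuous_const
    · simp [hc]
    · simp [hc, hv]
    · rw [intervalIntegral.integral_congr (g := fun _ => √((x - x') ^ 2 + ‖z - z'‖ ^ 2))]
      · simp
      · intro s hs
        rw [uIcc_of_le zero_le_one] at hs
        simp only
        rw [(hd s).hasDerivWithinAt.derivWithin (uniqueDiffOn_Icc_zero_one s hs),
          ← Real.sqrt_sq (norm_nonneg (frame _ _)), norm_frame_sq]
        rw [norm_sub_rev z z']
        congr 1
        simp only [hv]
        ring
  · rintro ℓ ⟨γ, hγ, hM, h0, h1, rfl⟩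
    obtain ⟨θ, k, hθ0, hk, hθ, hn, hlift⟩ := exists_angle_lift hγ hM x
    have hU : UniqueDiffOn ℝ (Icc (0 : ℝ) 1) := uniqueDiffOn_Icc_zero_one
    have hcos := hlift (by simp [h0]) (by simp [h0])
    simp only [h1, wrap_zero, wrap_one, ← Real.cos_sub] at hcos
    have hle : |x' - x| ≤ |θ 1 - x| :=
      abs_le_abs_of_cos_sub_eq_one h (by rwa [sub_sub_sub_cancel_right])
    have hγ'c : ContinuousOn (derivWithin γ (Icc 0 1)) (Icc 0 1) :=
      hγ.continuousOn_derivWithin hU le_rfl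
    -- The unwrapped curve, with its angle stored in coordinate `0`. It is placed in the ambient
    -- space to have the Euclidean norm, since the product `ℝ × ℝⁿ` carries the max norm. It has the
    -- speed of `γ`, and its length is at least its chord.
    set η : ℝ → Ambient n := fun s => θ s • axis n 0 + padL n (tailL n (γ s)) with hη
    set η' : ℝ → Ambient n := fun s =>
      k s • axis n 0 + padL n (tailL n (derivWithin γ (Icc 0 1) s)) with hη'
    have hηd : ∀ s ∈ Icc (0 : ℝ) 1, HasDerivWithinAt η (η' s) (Icc 0 1) s := fun s hs =>
      ((hθ s).hasDerivWithinAt.smul_const _).add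
        ((padL n ∘L tailL n).hasFDerivAt.comp_hasDerivWithinAt s
          (hγ.differentiableOn one_ne_zero s hs).hasDerivWithinAt)
    have hη'c : ContinuousOn η' (Icc 0 1) :=
      (hk.continuousOn.smul continuousOn_const).add
        ((padL n ∘L tailL n).continuous.comp_continuousOn hγ'c)
    have hint : ∫ s in (0 : ℝ)..1, η' s = η 1 - η 0 :=
      intervalIntegral.integral_eq_sub_of_hasDeriv_right_of_le zero_le_one
        (fun s hs => (hηd s hs).continuousWithinAt)
        (fun s hs => ((hηd s (Ioo_subset_Icc_self hs)).hasDerivAt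
          (Icc_mem_nhds hs.1 hs.2)).hasDerivWithinAt)
        (ContinuousOn.intervalIntegrable (by rwa [uIcc_of_le zero_le_one]))
    have hnorm : ∀ s ∈ Icc (0 : ℝ) 1, ‖derivWithin γ (Icc 0 1) s‖ = ‖η' s‖ := fun s hs => by
      rw [← sq_eq_sq₀ (norm_nonneg _) (norm_nonneg _), hn s hs, ambient_norm_sq]
      simp [hη']
    calc √((x - x') ^ 2 + ‖z - z'‖ ^ 2) ≤ ‖η 1 - η 0‖ := by
          refine Real.sqrt_le_iff.2 ⟨norm_nonneg _, ?_⟩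
          rw [ambient_norm_sq]
          have e1 : (x' - x) ^ 2 ≤ (θ 1 - x) ^ 2 := sq_le_sq.2 hle
          have e2 : (η 1 - η 0) 0 = θ 1 - x := by simp [hη, hθ0]
          have e3 : (η 1 - η 0) 1 = 0 := by simp [hη]
          have e4 : tailL n (η 1 - η 0) = z' - z := by simp [hη, h0, h1]
          rw [e2, e3, e4, norm_sub_rev z z']
          linarith
      _ = ‖∫ s in (0 : ℝ)..1, η' s‖ := by rw [hint]
      _ ≤ ∫ s in (0 : ℝ)..1, ‖η' s‖ :=
          intervalIntegral.norm_integral_le_integral_norm zero_le_one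
      _ = ∫ s in (0 : ℝ)..1, ‖derivWithin γ (Icc 0 1) s‖ := by
          refine intervalIntegral.integral_congr fun s hs => ?_
          rw [uIcc_of_le zero_le_one] at hs
          exact (hnorm s hs).symm

end

/-! ### Coupled characteristics: uniqueness and local existence -/

noncomputable section

open Metric NNReal

section ODE

variable {E : Type*} [NormedAddCommGroup E] [NormedSpace ℝ E]

/-- Uniqueness for a family of coupled curves: if the velocities differ by at most `L` times any
uniform bound of the differences of the positions, curves with the same initial positions and a
bounded distance agree. -/
lemma eq_of_norm_velocity_sub_le {I : Type*} {T L M : ℝ} (hL0 : 0 ≤ L) {α β α' β' : I → ℝ → E}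
    (hα : ∀ i, ∀ t ∈ Ico 0 T, HasDerivWithinAt (α i) (α' i t) (Ico 0 T) t)
    (hβ : ∀ i, ∀ t ∈ Ico 0 T, HasDerivWithinAt (β i) (β' i t) (Ico 0 T) t)
    (h0 : ∀ i, α i 0 = β i 0) (hM : ∀ i, ∀ t ∈ Ico 0 T, ‖α i t - β i t‖ ≤ M)
    (hL : ∀ t ∈ Ico 0 T, ∀ A, (∀ i, ‖α i t - β i t‖ ≤ A) → ∀ i, ‖α' i t - β' i t‖ ≤ L * A)
    (i : I) {t : ℝ} (ht : t ∈ Ico 0 T) : α i t = β i t := by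
  have hM0 : 0 ≤ M := (norm_nonneg _).trans (hM i t ht)
  -- Picard iteration in the weight `exp (2Lt)`: integrating `L * exp (2Ls)` gains a factor `1/2` at
  -- each round. The supremum over `i` is never differentiated or integrated.
  have key : ∀ m : ℕ, ∀ i, ∀ t ∈ Ico 0 T,
      ‖α i t - β i t‖ ≤ M * (1 / 2) ^ m * Real.exp (2 * L * t) := by
    intro m
    induction m with
    | zero =>
      intro i t ht
      have : 1 ≤ Real.exp (2 * L * t) := Real.one_le_exp (by have := ht.1; positivity)
      simpa using (hM i t ht).trans (le_mul_of_one_le_right hM0 this)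
    | succ m ih =>
      intro i t ht
      have hsub : Icc 0 t ⊆ Ico 0 T := fun s hs => ⟨hs.1, hs.2.trans_lt ht.2⟩
      have hd : ∀ s ∈ Ico 0 T,
          HasDerivWithinAt (fun s => α i s - β i s) (α' i s - β' i s) (Ico 0 T) s :=
        fun s hs => (hα i s hs).fun_sub (hβ i s hs)
      refine image_norm_le_of_norm_deriv_right_le_deriv_boundary
        (f := fun s => α i s - β i s) (f' := fun s => α' i s - β' i s) (a := 0) (b := t)
        (B := fun s => M * (1 / 2) ^ (m + 1) * Real.exp (2 * L * s))
        (B' := fun s => L * (M * (1 / 2) ^ m * Real.exp (2 * L * s)))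
        (fun s hs => ((hd s (hsub hs)).mono hsub).continuousWithinAt)
        (fun s hs => (hd s (hsub (Ico_subset_Icc_self hs))).mono_of_mem_nhdsWithin
          (Ico_mem_nhdsGE_of_mem (hsub (Ico_subset_Icc_self hs))))
        (by simp only [h0 i, sub_self, norm_zero]; positivity) (fun s => ?_)
        (fun s hs => hL s (hsub (Ico_subset_Icc_self hs)) _
          (fun j => ih j s (hsub (Ico_subset_Icc_self hs))) i) (right_mem_Icc.2 ht.1)
      have := (((hasDerivAt_id s).const_mul (2 * L)).exp).const_mul (M * (1 / 2) ^ (m + 1))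
      refine this.congr_deriv ?_
      simp only [id, pow_succ]
      ring
  have hlim : Filter.Tendsto (fun m : ℕ => M * (1 / 2) ^ m * Real.exp (2 * L * t)) Filter.atTop
      (nhds (M * 0 * Real.exp (2 * L * t))) :=
    ((_root_.tendsto_pow_atTop_nhds_zero_of_lt_one (by norm_num) (by norm_num)).const_mul M).mul_const _
  have := ge_of_tendsto' hlim fun m => key m i t ht
  simp only [mul_zero, zero_mul] at this
  exact sub_eq_zero.1 (norm_le_zero_iff.1 this)

/-- Uniqueness of the integral curves of a vector field that is Lipschitz on bounded sets. -/
lemma integralCurve_unique {T : ℝ} {X : ℝ → E → E}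
    (hX : ∀ R, ∃ L : ℝ≥0, ∀ t ∈ Ico 0 T, LipschitzOnWith L (X t) (closedBall 0 R)) {α β : ℝ → E}
    (hα : ∀ t ∈ Ico 0 T, HasDerivWithinAt α (X t (α t)) (Ico 0 T) t)
    (hβ : ∀ t ∈ Ico 0 T, HasDerivWithinAt β (X t (β t)) (Ico 0 T) t)
    (h0 : α 0 = β 0) {t : ℝ} (ht : t ∈ Ico 0 T) : α t = β t := by
  -- Before `τ < T` both curves are bounded, so a single Lipschitz constant serves.
  obtain ⟨τ, hτt, hτT⟩ := exists_between ht.2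
  have hsub : Icc 0 τ ⊆ Ico 0 T := fun s hs => ⟨hs.1, hs.2.trans_lt hτT⟩
  have hsub' : Ico 0 τ ⊆ Ico 0 T := Ico_subset_Icc_self.trans hsub
  have hbdd : ∀ {γ γ' : ℝ → E}, (∀ t ∈ Ico 0 T, HasDerivWithinAt γ (γ' t) (Ico 0 T) t) →
      ∃ R, ∀ t ∈ Icc 0 τ, ‖γ t‖ ≤ R := fun h =>
    isCompact_Icc.exists_bound_of_continuousOn
      fun s hs => ((h s (hsub hs)).mono hsub).continuousWithinAt
  obtain ⟨R₁, hR₁⟩ := hbdd hα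
  obtain ⟨R₂, hR₂⟩ := hbdd hβ
  obtain ⟨L, hL⟩ := hX (max R₁ R₂)
  refine eq_of_norm_velocity_sub_le (I := Unit) (T := τ) (L := L) (M := R₁ + R₂) L.2
    (α := fun _ => α) (β := fun _ => β) (fun _ s hs => (hα s (hsub' hs)).mono hsub')
    (fun _ s hs => (hβ s (hsub' hs)).mono hsub') (fun _ => h0) (fun _ s hs => ?_)
    (fun s hs A hA _ => ?_) () ⟨ht.1, hτt⟩
  · exact (norm_sub_le _ _).trans
      (add_le_add (hR₁ s (Ico_subset_Icc_self hs)) (hR₂ s (Ico_subset_Icc_self hs)))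
  · refine ((hL s (hsub' hs)).norm_sub_le ?_ ?_).trans
      (mul_le_mul_of_nonneg_left (hA ()) L.2)
    · exact mem_closedBall_zero_iff.2 ((hR₁ s (Ico_subset_Icc_self hs)).trans (le_max_left _ _))
    · exact mem_closedBall_zero_iff.2 ((hR₂ s (Ico_subset_Icc_self hs)).trans (le_max_right _ _))

/-- Picard–Lindelöf for an autonomous field, with a solution that stays in the ball where the field
is bounded and Lipschitz. -/
lemma exists_integralCurve_mem_closedBall [CompleteSpace E] {G : E → E} {x₀ : E} {a B K : ℝ≥0}
    (hB : ∀ x ∈ closedBall x₀ a, ‖G x‖ ≤ B) (hK : LipschitzOnWith K G (closedBall x₀ a)) {T : ℝ}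
    (hT : 0 ≤ T) (hBT : B * T ≤ a) :
    ∃ α : ℝ → E, α 0 = x₀ ∧ Continuous α ∧ (∀ t, α t ∈ closedBall x₀ (a : ℝ)) ∧
      ∀ t ∈ Icc 0 T, HasDerivWithinAt α (G (α t)) (Icc 0 T) t := by
  have hPL : IsPicardLindelof (fun _ => G) (⟨0, left_mem_Icc.2 hT⟩ : Icc 0 T) x₀ a 0 B K :=
    IsPicardLindelof.of_time_independent hB hK (by simpa [hT] using hBT)
  -- The fixed point of the Picard operator itself is kept, because its values are known to lie in
  -- the ball; `compProj` extends it constantly outside `[0, T]`.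
  obtain ⟨α, hα⟩ := ODE.FunSpace.exists_isFixedPt_next hPL (mem_closedBall_self le_rfl)
  refine ⟨α.compProj, ?_, α.continuous_compProj,
    fun t => α.compProj_mem_closedBall hPL.mul_max_le, fun t ht => ?_⟩
  · have := ODE.FunSpace.compProj_val (α := α) (t := ⟨0, left_mem_Icc.2 hT⟩)
    rw [this, ← hα, ODE.FunSpace.next_apply₀]
  · apply ODE.hasDerivWithinAt_picard_Icc (left_mem_Icc.2 hT) hPL.continuousOn_uncurry
      α.continuous_compProj.continuousOn
      (fun _ _ => α.compProj_mem_closedBall hPL.mul_max_le) x₀ ht |>.congr_of_mem _ ht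
    intro t' ht'
    nth_rw 1 [← hα]
    rw [ODE.FunSpace.compProj_of_mem ht', ODE.FunSpace.next_apply]

lemma LocallyLipschitz.exists_lipschitzOnWith_closedBall {E : Type*} [NormedAddCommGroup E]
    [ProperSpace E] {F : E → E} (hF : LocallyLipschitz F) (R : ℝ) :
    ∃ L : ℝ≥0, LipschitzOnWith L F (closedBall 0 R) :=
  (hF.locallyLipschitzOn).exists_lipschitzOnWith_of_compact (isCompact_closedBall 0 R)

variable [ProperSpace E] {F : E → E}

/-- Difference of two averaged interactions. -/
lemma norm_integral_interaction_sub_le {Y : Type*} [MeasurableSpace Y] {μ : Measure Y}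
    [IsProbabilityMeasure μ] {R A : ℝ} {L : ℝ≥0} (hF : Continuous F)
    (hL : LipschitzOnWith L F (closedBall 0 (R + R))) {a b : E} {p q : Y → E} [MeasurableSpace E]
    [BorelSpace E]
    (hp : AEMeasurable p μ) (hq : AEMeasurable q μ) (ha : ‖a‖ ≤ R) (hb : ‖b‖ ≤ R)
    (hpR : ∀ᵐ y ∂μ, ‖p y‖ ≤ R) (hqR : ∀ᵐ y ∂μ, ‖q y‖ ≤ R) (hab : ‖a - b‖ ≤ A)
    (hpq : ∀ᵐ y ∂μ, ‖p y - q y‖ ≤ A) :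
    ‖(∫ y, F (a - p y) ∂μ) - ∫ y, F (b - q y) ∂μ‖ ≤ 2 * L * A := by
  have hint : ∀ {c : E} {r : Y → E}, AEMeasurable r μ → ‖c‖ ≤ R → (∀ᵐ y ∂μ, ‖r y‖ ≤ R) →
      Integrable (fun y => F (c - r y)) μ := by
    intro c r hr hc hrR
    obtain ⟨B, hB⟩ := (isCompact_closedBall (0 : E) (R + R)).exists_bound_of_continuousOn
      hF.continuousOn
    refine Integrable.of_bound
      (hF.comp_aestronglyMeasurable (hr.const_sub c).aestronglyMeasurable) B ?_
    filter_upwards [hrR] with y hy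
    exact hB _ (mem_closedBall_zero_iff.2 ((norm_sub_le _ _).trans (add_le_add hc hy)))
  rw [← integral_sub (hint hp ha hpR) (hint hq hb hqR)]
  refine (norm_integral_le_of_norm_le_const (C := 2 * L * A) ?_).trans (by simp)
  filter_upwards [hpR, hqR, hpq] with y hy1 hy2 hy3
  refine (hL.norm_sub_le
    (mem_closedBall_zero_iff.2 ((norm_sub_le _ _).trans (add_le_add ha hy1)))
    (mem_closedBall_zero_iff.2 ((norm_sub_le _ _).trans (add_le_add hb hy2)))).trans ?_
  -- The factor `2` of the bound: the target and the source each move by at most `A`.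
  have : ‖a - p y - (b - q y)‖ ≤ A + A := by
    rw [sub_sub_sub_comm]
    exact (norm_sub_le _ _).trans (add_le_add hab hy3)
  calc (L : ℝ) * ‖a - p y - (b - q y)‖ ≤ L * (A + A) := by gcongr
    _ = 2 * L * A := by ring

variable {Y : Type*} [TopologicalSpace Y] [CompactSpace Y] [MeasurableSpace Y]
  [OpensMeasurableSpace Y]

/-- Local existence for the Lagrangian form of the aggregation equation. -/
lemma exists_lagrangian_flow (hF : LocallyLipschitz F) (ι : C(Y, E)) {r : ℝ} (hr : 0 < r)
    (μ : Measure Y) [IsProbabilityMeasure μ] :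
    ∃ T > 0, ∃ Φ : ℝ → C(Y, E), Φ 0 = ι ∧ Continuous Φ ∧ (∀ t y, ‖Φ t y - ι y‖ ≤ r) ∧
      ∀ y, ∀ t ∈ Ico 0 T,
        HasDerivWithinAt (fun s => Φ s y) (∫ y', F (Φ t y - Φ t y') ∂μ) (Ico 0 T) t := by
  borelize E
  have hFc := hF.continuous
  set R := ‖ι‖ + r with hR
  obtain ⟨L, hL⟩ := hF.exists_lipschitzOnWith_closedBall (R + R)
  obtain ⟨B, hB⟩ := (isCompact_closedBall (0 : E) (R + R)).exists_bound_of_continuousOn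
    hFc.continuousOn
  have hB0 : 0 ≤ B := (norm_nonneg _).trans (hB 0 (mem_closedBall_self (by positivity)))
  -- The velocity as an autonomous vector field on `C(Y, E)`.
  set G : C(Y, E) → C(Y, E) := fun φ =>
    ⟨fun y => ∫ y', F (φ y - φ y') ∂μ, by
      have h := continuous_parametric_integral_of_continuous (X := E) (μ := μ)
        (f := fun e y' => F (e - φ y'))
        (hFc.comp (continuous_fst.sub (φ.continuous.comp continuous_snd))) isCompact_univ
      simp only [Measure.restrict_univ] at h
      exact h.comp φ.continuous⟩ with hG
  have hball : ∀ φ ∈ closedBall ι r, ∀ y, ‖φ y‖ ≤ R := fun φ hφ y => by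
    refine (φ.norm_coe_le_norm y).trans ?_
    rw [mem_closedBall, dist_eq_norm] at hφ
    calc ‖φ‖ = ‖ι + (φ - ι)‖ := by rw [add_sub_cancel]
      _ ≤ R := (norm_add_le _ _).trans (add_le_add_right hφ _)
  have hGB : ∀ φ ∈ closedBall ι r, ‖G φ‖ ≤ B := fun φ hφ => by
    refine (ContinuousMap.norm_le _ hB0).2 fun y => ?_
    refine (norm_integral_le_of_norm_le_const (C := B) (Filter.Eventually.of_forall fun y' =>
      hB _ (mem_closedBall_zero_iff.2 ((norm_sub_le _ _).trans
        (add_le_add (hball φ hφ y) (hball φ hφ y')))))).trans (by simp)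
  have hGL : LipschitzOnWith (2 * L) G (closedBall ι r) := by
    refine LipschitzOnWith.of_dist_le_mul fun φ hφ ψ hψ => ?_
    rw [ContinuousMap.dist_le (by positivity)]
    intro y
    rw [dist_eq_norm, dist_eq_norm]
    exact norm_integral_interaction_sub_le hFc hL φ.continuous.measurable.aemeasurable
      ψ.continuous.measurable.aemeasurable (hball φ hφ y) (hball ψ hψ y)
      (Filter.Eventually.of_forall (hball φ hφ)) (Filter.Eventually.of_forall (hball ψ hψ))
      ((φ - ψ).norm_coe_le_norm y)
      (Filter.Eventually.of_forall ((φ - ψ).norm_coe_le_norm))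
  -- At speed at most `B` the ball of radius `r` is not left before `T`; the `+ 1` covers `B = 0`.
  set T := r / (B + 1) with hT
  have hT0 : 0 < T := by positivity
  lift B to ℝ≥0 using hB0
  lift r to ℝ≥0 using hr.le
  obtain ⟨α, h0, hc, hmem, hd⟩ := exists_integralCurve_mem_closedBall hGB hGL hT0.le (by
    rw [hT, mul_div_assoc', div_le_iff₀ (by positivity)]
    nlinarith)
  refine ⟨T, hT0, α, h0, hc, fun t y => ?_, fun y t ht => ?_⟩
  · have := hmem t
    rw [mem_closedBall, dist_eq_norm] at this
    exact ((α t - ι).norm_coe_le_norm y).trans this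
  · exact ((ContinuousMap.evalCLM ℝ y).hasFDerivAt.comp_hasDerivWithinAt t
      (hd t (Ico_subset_Icc_self ht))).mono Ico_subset_Icc_self

end ODE

end

/-! ### The surface gradient of the potential in flat coordinates -/

noncomputable section

section Gradient

variable {n : ℕ}

/-- The squared Euclidean norm in the flat coordinates of the hypercylinder. -/
def flatSq (w : ℝ × EuclideanSpace ℝ (Fin n)) : ℝ := w.1 ^ 2 + ‖w.2‖ ^ 2

lemma flatSq_nonneg (w : ℝ × EuclideanSpace ℝ (Fin n)) : 0 ≤ flatSq w := by
  unfold flatSq; positivity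

lemma contDiff_flatSq : ContDiff ℝ 1 (flatSq : ℝ × EuclideanSpace ℝ (Fin n) → ℝ) :=
  (contDiff_fst.pow 2).add (contDiff_snd.norm_sq ℝ)

lemma fderiv_flatSq (w v : ℝ × EuclideanSpace ℝ (Fin n)) :
    fderiv ℝ flatSq w v = 2 * (w.1 * v.1 + inner ℝ w.2 v.2) := by
  have h1 := (hasFDerivAt_fst (𝕜 := ℝ) (p := w)).pow 2
  have h2 := (hasFDerivAt_snd (𝕜 := ℝ) (p := w)).norm_sq
  rw [show (flatSq : ℝ × EuclideanSpace ℝ (Fin n) → ℝ) = fun w => w.1 ^ 2 + ‖w.2‖ ^ 2 from rfl,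
    (h1.fun_add h2).fderiv]
  simp
  ring

/-- Minus the gradient of `w ↦ g (|w|²)`, in the flat coordinates. -/
def flatForce (g : ℝ → ℝ) (w : ℝ × EuclideanSpace ℝ (Fin n)) : ℝ × EuclideanSpace ℝ (Fin n) :=
  -(2 * derivWithin g (Ici 0) (flatSq w)) • w

lemma locallyLipschitz_flatForce {g : ℝ → ℝ}
    (hg : LocallyLipschitzOn (Ici 0) (derivWithin g (Ici 0))) :
    LocallyLipschitz (flatForce g : ℝ × EuclideanSpace ℝ (Fin n) → _) := by
  have h1 : LocallyLipschitz fun w : ℝ × EuclideanSpace ℝ (Fin n) =>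
      derivWithin g (Ici 0) (flatSq w) := by
    intro w
    obtain ⟨K₁, t, ht, hK₁⟩ := hg (flatSq_nonneg w : flatSq w ∈ Ici 0)
    obtain ⟨K₂, s, hs, hK₂⟩ := contDiff_flatSq.locallyLipschitz w
    -- A neighbourhood relative to `[0, ∞)` pulls back to a full neighbourhood because `flatSq` is
    -- nonnegative.
    have ht' : flatSq ⁻¹' t ∈ nhds w :=
      (tendsto_nhdsWithin_iff.2 ⟨contDiff_flatSq.continuous.continuousAt,
        Filter.Eventually.of_forall flatSq_nonneg⟩ :
        Filter.Tendsto flatSq (nhds w) (nhdsWithin (flatSq w) (Ici 0))) ht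
    exact ⟨K₁ * K₂, s ∩ flatSq ⁻¹' t, Filter.inter_mem hs ht',
      hK₁.comp (hK₂.mono inter_subset_left) fun x hx => hx.2⟩
  have h2 : ContDiff ℝ 1 fun p : ℝ × (ℝ × EuclideanSpace ℝ (Fin n)) => -(2 * p.1) • p.2 :=
    (contDiff_const.mul contDiff_fst).neg.smul contDiff_snd
  have h3 := h2.locallyLipschitz
  have h4 := h1.prodMk LocallyLipschitz.id
  have h5 : flatForce g = (fun p : ℝ × (ℝ × EuclideanSpace ℝ (Fin n)) => -(2 * p.1) • p.2) ∘
      fun w => (derivWithin g (Ici 0) (flatSq w), id w) := rfl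
  rw [h5]
  exact h3.comp h4

/-- The flat coordinates on the half of the hypercylinder where the second coordinate is
positive. -/
def flatChart (p : Ambient n) : ℝ × EuclideanSpace ℝ (Fin n) := (Real.arccos (p 0), tailL n p)

lemma continuous_flatChart : Continuous (flatChart : Ambient n → _) :=
  (Real.continuous_arccos.comp (coordL n 0).continuous).prodMk (tailL n).continuous

lemma flatChart_wrap {u : ℝ × EuclideanSpace ℝ (Fin n)} (hu : u.1 ∈ Ioo 0 Real.pi) :
    flatChart (wrap u.1 u.2) = u := by
  simp [flatChart, Real.arccos_cos hu.1.le hu.2.le]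

lemma flatChart_fst_mem {p : Ambient n} (hp : p ∈ Hypercylinder n) (h1 : 0 < p 1) :
    (flatChart p).1 ∈ Ioo 0 Real.pi := by
  have hp : p 0 ^ 2 + p 1 ^ 2 = 1 := hp
  exact ⟨Real.arccos_pos.2 (by nlinarith), Real.arccos_lt_pi.2 (by nlinarith)⟩

lemma wrap_flatChart {p : Ambient n} (hp : p ∈ Hypercylinder n) (h1 : 0 < p 1) :
    wrap (flatChart p).1 (flatChart p).2 = p := by
  have hp : p 0 ^ 2 + p 1 ^ 2 = 1 := hp
  apply ambient_ext
  · simp only [wrap_zero, flatChart]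
    exact Real.cos_arccos (by nlinarith) (by nlinarith)
  · simp only [wrap_one, flatChart, Real.sin_arccos]
    rw [show 1 - p 0 ^ 2 = p 1 ^ 2 by linarith, Real.sqrt_sq h1.le]
  · simp [flatChart]

lemma differentiableAt_flatChart {u : ℝ × EuclideanSpace ℝ (Fin n)} (hu : u.1 ∈ Ioo 0 Real.pi) :
    DifferentiableAt ℝ flatChart (wrap u.1 u.2) := by
  refine DifferentiableAt.prodMk ?_ (tailL n).differentiableAt
  have hs := Real.sin_pos_of_mem_Ioo hu
  have := Real.sin_sq_add_cos_sq u.1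
  exact (Real.differentiableAt_arccos.2
    ⟨fun h => by simp only [wrap_zero] at h; nlinarith,
      fun h => by simp only [wrap_zero] at h; nlinarith⟩).comp (wrap u.1 u.2)
    (coordL n 0).differentiableAt

/-- The chart is a left inverse of `wrap` near `u`, and `frame` is the differential of `wrap`. -/
lemma fderiv_flatChart_frame {u : ℝ × EuclideanSpace ℝ (Fin n)} (hu : u.1 ∈ Ioo 0 Real.pi)
    (w : ℝ × EuclideanSpace ℝ (Fin n)) :
    fderiv ℝ flatChart (wrap u.1 u.2) (frame u.1 w) = w := by
  have h := (differentiableAt_flatChart hu).hasFDerivAt.comp u (hasFDerivAt_wrap u)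
  have h' : HasFDerivAt (flatChart ∘ fun u : ℝ × EuclideanSpace ℝ (Fin n) => wrap u.1 u.2)
      (ContinuousLinearMap.id ℝ _) u := by
    refine (hasFDerivAt_id u).congr_of_eventuallyEq ?_
    filter_upwards [(isOpen_Ioo.preimage continuous_fst).mem_nhds hu] with v hv
    exact flatChart_wrap hv
  exact congrArg (fun A => A w) (h.unique h')

lemma mem_tangentAt_iff {u : ℝ × EuclideanSpace ℝ (Fin n)} {v : Ambient n} :
    v ∈ tangentAt (wrap u.1 u.2) ↔ ∃ w, v = frame u.1 w := by
  constructor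
  · intro hv
    have hv : Real.cos u.1 * v 0 + Real.sin u.1 * v 1 = 0 := hv
    have h1 := Real.sin_sq_add_cos_sq u.1
    refine ⟨(-Real.sin u.1 * v 0 + Real.cos u.1 * v 1, tailL n v), ambient_ext ?_ ?_ ?_⟩
    · simp only [frame_zero]
      linear_combination Real.cos u.1 * hv - v 0 * h1
    · simp only [frame_one]
      linear_combination Real.sin u.1 * hv - v 1 * h1
    · simp
  · rintro ⟨w, rfl⟩
    change wrap u.1 u.2 0 * frame u.1 w 0 + wrap u.1 u.2 1 * frame u.1 w 1 = 0
    simp only [wrap_zero, wrap_one, frame_zero, frame_one]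
    ring

lemma inner_frame (x : ℝ) (v w : ℝ × EuclideanSpace ℝ (Fin n)) :
    inner ℝ (frame x v) (frame x w) = v.1 * w.1 + inner ℝ v.2 w.2 := by
  rw [ambient_inner]
  simp only [frame_zero, frame_one, tailL_frame]
  linear_combination v.1 * w.1 * Real.sin_sq_add_cos_sq x

/-- The surface gradient in flat coordinates. -/
lemma surfaceGradient_eq_frame {f : Ambient n → ℝ} {h : ℝ × EuclideanSpace ℝ (Fin n) → ℝ}
    {h' : ℝ × EuclideanSpace ℝ (Fin n) →L[ℝ] ℝ} {u q : ℝ × EuclideanSpace ℝ (Fin n)}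
    (hu : u.1 ∈ Ioo 0 Real.pi) (hh : HasFDerivAt h h' u)
    (hf : ∀ v : ℝ × EuclideanSpace ℝ (Fin n), v.1 ∈ Ioo 0 Real.pi → f (wrap v.1 v.2) = h v)
    (hq : ∀ w, h' w = q.1 * w.1 + inner ℝ q.2 w.2) :
    surfaceGradient f (wrap u.1 u.2) = frame u.1 q := by
  have hW := hasFDerivAt_wrap u
  have hdiff : DifferentiableWithinAt ℝ f (Hypercylinder n) (wrap u.1 u.2) := by
    have h1 : DifferentiableAt ℝ (h ∘ flatChart) (wrap u.1 u.2) := by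
      refine DifferentiableAt.comp _ ?_ (differentiableAt_flatChart hu)
      rw [flatChart_wrap hu]
      exact hh.differentiableAt
    have hpos : ∀ᶠ p : Ambient n in nhds (wrap u.1 u.2), 0 < p 1 :=
      (coordL n 1).continuous.continuousAt.eventually_const_lt
        (by simpa using Real.sin_pos_of_mem_Ioo hu)
    refine h1.differentiableWithinAt.congr_of_eventuallyEq ?_ ?_
    · filter_upwards [self_mem_nhdsWithin, mem_nhdsWithin_of_mem_nhds hpos] with p hp hp1
      have := hf (flatChart p) (flatChart_fst_mem hp hp1)
      rwa [wrap_flatChart hp hp1] at this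
    · rw [hf u hu, Function.comp_apply, flatChart_wrap hu]
  set D := fderivWithin ℝ f (Hypercylinder n) (wrap u.1 u.2) with hD
  -- The hypercylinder has empty interior, so `D` is not determined in the normal direction. The
  -- chain rule along `wrap` determines it on tangent vectors, and the projection retains nothing
  -- else.
  have hchain : D.comp (frame u.1) = h' := by
    have h1 : HasFDerivAt (f ∘ fun u : ℝ × EuclideanSpace ℝ (Fin n) => wrap u.1 u.2)
        (D.comp (frame u.1)) u := by
      rw [← hasFDerivWithinAt_univ]
      exact hdiff.hasFDerivWithinAt.comp u hW.hasFDerivWithinAt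
        fun v _ => wrap_mem_hypercylinder _ _
    refine h1.unique (hh.congr_of_eventuallyEq ?_)
    filter_upwards [(isOpen_Ioo.preimage continuous_fst).mem_nhds hu] with v hv
    exact hf v hv
  refine Submodule.eq_starProjection_of_mem_of_inner_eq_zero (mem_tangentAt_iff.2 ⟨q, rfl⟩) ?_
  intro v hv
  obtain ⟨w, rfl⟩ := mem_tangentAt_iff.1 hv
  rw [inner_sub_left, inner_frame, ← hq, ← hchain, gradientWithin,
    InnerProductSpace.toDual_symm_apply, ContinuousLinearMap.comp_apply, sub_self]

/-- Angles in `(0, π)` differ by less than `π`, so `intrinsicDist_wrap` turns the potential into `g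
∘ flatSq` of the difference of the coordinates. -/
lemma surfaceGradient_potential {K : Ambient n → Ambient n → ℝ} {g : ℝ → ℝ}
    (hg : DifferentiableOn ℝ g (Ici 0))
    (hK : ∀ x ∈ Hypercylinder n, ∀ y ∈ Hypercylinder n, K x y = g (intrinsicDist x y ^ 2))
    {u u' : ℝ × EuclideanSpace ℝ (Fin n)} (hu : u.1 ∈ Ioo 0 Real.pi)
    (hu' : u'.1 ∈ Ioo 0 Real.pi) :
    surfaceGradient (fun p => K p (wrap u'.1 u'.2)) (wrap u.1 u.2) =
      -frame u.1 (flatForce g (u - u')) := by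
  rw [← map_neg]
  have h1 : HasFDerivAt (fun v => flatSq (v - u')) (fderiv ℝ flatSq (u - u')) u :=
    (hasFDerivAt_comp_sub u').2 (contDiff_flatSq.differentiable one_ne_zero (u - u')).hasFDerivAt
  have h2 : HasFDerivAt (fun v => g (flatSq (v - u')))
      (derivWithin g (Ici 0) (flatSq (u - u')) • fderiv ℝ flatSq (u - u')) u := by
    -- Only a derivative of `g` within `[0, ∞)` is available; it suffices, even at `u = u'`, as
    -- `flatSq` takes its values there.
    rw [← hasFDerivWithinAt_univ]
    exact ((hg _ (flatSq_nonneg (u - u'))).hasDerivWithinAt).comp_hasFDerivWithinAt u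
      h1.hasFDerivWithinAt fun v _ => flatSq_nonneg _
  refine surfaceGradient_eq_frame hu h2 (fun v hv => ?_) fun w => ?_
  · rw [hK _ (wrap_mem_hypercylinder _ _) _ (wrap_mem_hypercylinder _ _), intrinsicDist_wrap,
      Real.sq_sqrt (by positivity)]
    · rfl
    · exact abs_le.2 ⟨by linarith [hu'.1, hv.2], by linarith [hu'.2, hv.1]⟩
  · simp [fderiv_flatSq, flatForce, inner_smul_left]
    ring

end Gradient

end

/-! ### The characteristic equations in flat coordinates -/

noncomputable section

open Metric NNReal

section Band

variable {n : ℕ} {ε : ℝ}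

lemma band_one_pos (hε : 0 < ε) (x : band n ε) : 0 < (x : Ambient n) 1 := by
  obtain ⟨_, a, ha, z, rfl⟩ := x
  exact Real.sin_pos_of_pos_of_lt_pi ha.1 (by linarith [ha.2])

lemma band_mem_hypercylinder (x : band n ε) : (x : Ambient n) ∈ Hypercylinder n := by
  obtain ⟨_, a, ha, z, rfl⟩ := x
  exact wrap_mem_hypercylinder _ _

/-- The flat coordinates of a point of the band. -/
def bandChart (x : band n ε) : ℝ × EuclideanSpace ℝ (Fin n) := flatChart (x : Ambient n)

/-- The open set of the flat coordinates of the band. -/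
def flatBand (n : ℕ) (ε : ℝ) : Set (ℝ × EuclideanSpace ℝ (Fin n)) :=
  Prod.fst ⁻¹' Ioo 0 (Real.pi - ε)

/-- The point of the band with given flat coordinates. -/
def bandPoint (u : flatBand n ε) : band n ε := ⟨wrap u.1.1 u.1.2, u.1.1, u.2, u.1.2, rfl⟩

lemma isOpen_flatBand : IsOpen (flatBand n ε) := isOpen_Ioo.preimage continuous_fst

lemma continuous_bandChart : Continuous (bandChart : band n ε → _) :=
  continuous_flatChart.comp continuous_subtype_val

lemma wrap_bandChart (hε : 0 < ε) (x : band n ε) :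
    wrap (bandChart x).1 (bandChart x).2 = x :=
  wrap_flatChart (band_mem_hypercylinder x) (band_one_pos hε x)

lemma bandChart_injective (hε : 0 < ε) : Function.Injective (bandChart : band n ε → _) :=
  fun x y h => Subtype.ext (by rw [← wrap_bandChart hε x, h, wrap_bandChart hε y])

lemma bandChart_fst_mem (hε : 0 < ε) (x : band n ε) : (bandChart x).1 ∈ Ioo 0 Real.pi :=
  flatChart_fst_mem (band_mem_hypercylinder x) (band_one_pos hε x)

lemma bandChart_bandPoint (hε : 0 < ε) (u : flatBand n ε) :
    bandChart (bandPoint u) = u :=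
  flatChart_wrap ⟨u.2.1, u.2.2.trans (by linarith)⟩

lemma bandChart_mem (hε : 0 < ε) (x : band n ε) : bandChart x ∈ flatBand n ε := by
  obtain ⟨_, a, ha, z, rfl⟩ := x
  have := bandChart_bandPoint hε ⟨(a, z), ha⟩
  exact this ▸ ha

lemma continuous_bandPoint : Continuous (bandPoint : flatBand n ε → band n ε) := by
  refine Continuous.subtype_mk ?_ _
  have h : Continuous fun u : ℝ × EuclideanSpace ℝ (Fin n) => wrap u.1 u.2 :=
    continuous_iff_continuousAt.2 fun u => (hasFDerivAt_wrap u).continuousAt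
  exact h.comp continuous_subtype_val

lemma bandPoint_bandChart (hε : 0 < ε) (x : band n ε) :
    bandPoint ⟨bandChart x, bandChart_mem hε x⟩ = x :=
  bandChart_injective hε (bandChart_bandPoint hε _)

/-- Velocities in the frame and velocities in flat coordinates. -/
lemma hasDerivWithinAt_coe_iff (hε : 0 < ε) {ψ : ℝ → band n ε}
    {w : ℝ × EuclideanSpace ℝ (Fin n)} {s : Set ℝ} {t : ℝ} :
    HasDerivWithinAt (fun r => (ψ r : Ambient n)) (frame (bandChart (ψ t)).1 w) s t ↔
      HasDerivWithinAt (fun r => bandChart (ψ r)) w s t := by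
  constructor
  · intro h
    have hd := differentiableAt_flatChart (bandChart_fst_mem hε (ψ t))
    have e := fderiv_flatChart_frame (bandChart_fst_mem hε (ψ t)) w
    rw [wrap_bandChart hε] at hd e
    rw [← e]
    exact hd.hasFDerivAt.comp_hasDerivWithinAt t h
  · intro h
    have := (hasFDerivAt_wrap (bandChart (ψ t))).comp_hasDerivWithinAt t h
    exact this.congr (fun r _ => (wrap_bandChart hε _).symm) (wrap_bandChart hε _).symm

variable {K : Ambient n → Ambient n → ℝ} {g : ℝ → ℝ}

lemma integrable_flatForce
    (hg' : LocallyLipschitzOn (Ici 0) (derivWithin g (Ici 0))) {Q : Set (band n ε)}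
    (hQ : IsCompact Q) {ν : Measure (band n ε)} [IsFiniteMeasure ν] (hν : ν.support ⊆ Q)
    (e : ℝ × EuclideanSpace ℝ (Fin n)) :
    Integrable (fun y => flatForce g (e - bandChart y)) ν := by
  have hc : Continuous fun y : band n ε => flatForce g (e - bandChart y) :=
    (locallyLipschitz_flatForce hg').continuous.comp (continuous_const.sub continuous_bandChart)
  obtain ⟨B, hB⟩ := hQ.exists_bound_of_continuousOn hc.continuousOn
  refine Integrable.of_bound hc.aestronglyMeasurable B ?_
  filter_upwards [ν.support_mem_ae] with y hy using hB y (hν hy)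

/-- The frame depends on `x` alone and is linear, so it comes out of the integral over `y`. -/
lemma neg_integral_surfaceGradient (hε : 0 < ε) (hg : DifferentiableOn ℝ g (Ici 0))
    (hg' : LocallyLipschitzOn (Ici 0) (derivWithin g (Ici 0)))
    (hK : ∀ x ∈ Hypercylinder n, ∀ y ∈ Hypercylinder n, K x y = g (intrinsicDist x y ^ 2))
    {Q : Set (band n ε)} (hQ : IsCompact Q) {ν : Measure (band n ε)} [IsFiniteMeasure ν]
    (hν : ν.support ⊆ Q) (x : band n ε) :
    -∫ y : band n ε, surfaceGradient (fun p => K p y) x ∂ν =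
      frame (bandChart x).1 (∫ y, flatForce g (bandChart x - bandChart y) ∂ν) := by
  rw [← ContinuousLinearMap.integral_comp_comm _ (integrable_flatForce hg' hQ hν _),
    ← integral_neg]
  refine integral_congr_ae (Filter.Eventually.of_forall fun y => ?_)
  have := surfaceGradient_potential hg hK (bandChart_fst_mem hε x) (bandChart_fst_mem hε y)
  rw [wrap_bandChart hε, wrap_bandChart hε] at this
  simp only [this, neg_neg]

variable {T : ℝ}

/-- Flow maps of the velocity field in flat coordinates. -/
lemma isFlowMap_velocity_iff (hε : 0 < ε) (hg : DifferentiableOn ℝ g (Ici 0))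
    (hg' : LocallyLipschitzOn (Ici 0) (derivWithin g (Ici 0)))
    (hK : ∀ x ∈ Hypercylinder n, ∀ y ∈ Hypercylinder n, K x y = g (intrinsicDist x y ^ 2))
    {Q : Set (band n ε)} (hQ : IsCompact Q) {ρ : Ico 0 T → ProbabilityMeasure (band n ε)}
    (hρ : ∀ t, (ρ t : Measure (band n ε)).support ⊆ Q) {S : Set (band n ε)}
    {Ψ : ℝ → band n ε → band n ε} :
    IsFlowMap (velocity K ρ) S Ψ ↔ ∀ x ∈ S, Ψ 0 x = x ∧ ∀ t : Ico 0 T,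
      HasDerivWithinAt (fun s : ℝ => bandChart (Ψ s x))
        (∫ y, flatForce g (bandChart (Ψ t x) - bandChart y) ∂(ρ t : Measure (band n ε)))
        (Ico 0 T) t := by
  refine forall₂_congr fun x _ => and_congr_right' (forall_congr' fun t => ?_)
  rw [velocity, neg_integral_surfaceGradient hε hg hg' hK hQ (hρ t)]
  exact hasDerivWithinAt_coe_iff (ψ := fun s => Ψ s x) hε

/-! ### Uniqueness of flow maps and of weak solutions -/

lemma exists_norm_bandChart_le {Q : Set (band n ε)} (hQ : IsCompact Q) :
    ∃ R, ∀ x ∈ Q, ‖bandChart x‖ ≤ R :=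
  hQ.exists_bound_of_continuousOn continuous_bandChart.continuousOn

/-- For a given `ρ` the field is Lipschitz on bounded sets uniformly in time, since every `ρ t`
lives on the same compact set; no regularity in time is needed. -/
lemma flowMap_unique (hε : 0 < ε) (hg : DifferentiableOn ℝ g (Ici 0))
    (hg' : LocallyLipschitzOn (Ici 0) (derivWithin g (Ici 0)))
    (hK : ∀ x ∈ Hypercylinder n, ∀ y ∈ Hypercylinder n, K x y = g (intrinsicDist x y ^ 2))
    {Q : Set (band n ε)} (hQ : IsCompact Q) {ρ : Ico 0 T → ProbabilityMeasure (band n ε)}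
    (hρ : ∀ t, (ρ t : Measure (band n ε)).support ⊆ Q) {S : Set (band n ε)}
    {Ψ Φ : ℝ → band n ε → band n ε} (hΨ : IsFlowMap (velocity K ρ) S Ψ)
    (hΦ : IsFlowMap (velocity K ρ) S Φ) {x : band n ε} (hx : x ∈ S) {t : ℝ} (ht : t ∈ Ico 0 T) :
    Φ t x = Ψ t x := by
  classical
  rw [isFlowMap_velocity_iff hε hg hg' hK hQ hρ] at hΨ hΦ
  have hF := locallyLipschitz_flatForce (n := n) hg'
  obtain ⟨R₀, hR₀⟩ := exists_norm_bandChart_le hQ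
  set X : ℝ → ℝ × EuclideanSpace ℝ (Fin n) → ℝ × EuclideanSpace ℝ (Fin n) := fun t e =>
    if h : t ∈ Ico 0 T then ∫ y, flatForce g (e - bandChart y) ∂(ρ ⟨t, h⟩ : Measure (band n ε))
    else 0 with hX
  have hXL : ∀ R, ∃ L : ℝ≥0, ∀ t ∈ Ico 0 T, LipschitzOnWith L (X t) (closedBall 0 R) := by
    intro R
    obtain ⟨L, hL⟩ := hF.exists_lipschitzOnWith_closedBall (max R R₀ + max R R₀)
    refine ⟨2 * L, fun t ht => LipschitzOnWith.of_dist_le_mul fun a ha b hb => ?_⟩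
    simp only [hX, dif_pos ht]
    rw [mem_closedBall_zero_iff] at ha hb
    have hc : ∀ᵐ y ∂(ρ ⟨t, ht⟩ : Measure (band n ε)), ‖bandChart y‖ ≤ max R R₀ := by
      filter_upwards [Measure.support_mem_ae] with y hy
      exact (hR₀ y (hρ _ hy)).trans (le_max_right _ _)
    rw [dist_eq_norm, dist_eq_norm]
    exact norm_integral_interaction_sub_le hF.continuous hL
      continuous_bandChart.measurable.aemeasurable continuous_bandChart.measurable.aemeasurable
      (ha.trans (le_max_left _ _)) (hb.trans (le_max_left _ _)) hc hc le_rfl (by simp)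
  refine bandChart_injective hε (integralCurve_unique hXL (α := fun s => bandChart (Φ s x))
    (β := fun s => bandChart (Ψ s x)) (fun s hs => ?_) (fun s hs => ?_) ?_ ht)
  · simpa only [hX, dif_pos hs] using (hΦ x hx).2 ⟨s, hs⟩
  · simpa only [hX, dif_pos hs] using (hΨ x hx).2 ⟨s, hs⟩
  · simp only [(hΦ x hx).1, (hΨ x hx).1]

lemma integral_flatForce_map (hg' : LocallyLipschitzOn (Ici 0) (derivWithin g (Ici 0)))
    {μ : Measure (band n ε)} {ψ : band n ε → band n ε} (hψ : AEMeasurable ψ μ)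
    (e : ℝ × EuclideanSpace ℝ (Fin n)) :
    ∫ y, flatForce g (e - bandChart y) ∂(μ.map ψ) =
      ∫ y, flatForce g (e - bandChart (ψ y)) ∂μ :=
  integral_map hψ ((locallyLipschitz_flatForce hg').continuous.comp
    (continuous_const.sub continuous_bandChart)).aestronglyMeasurable

/-- Almost every trajectory of a transported measure supported in a closed set stays there. -/
lemma ae_forall_mem_of_map_support_subset {Q : Set (band n ε)} (hQ : IsClosed Q)
    {μ : Measure (band n ε)} {Ψ : ℝ → band n ε → band n ε}
    (hΨ : ∀ x ∈ μ.support, ContinuousOn (fun s => Ψ s x) (Ico 0 T))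
    (hm : ∀ t ∈ Ico 0 T, AEMeasurable (Ψ t) μ)
    (hs : ∀ t ∈ Ico 0 T, (μ.map (Ψ t)).support ⊆ Q) :
    ∀ᵐ x ∂μ, ∀ t ∈ Ico 0 T, Ψ t x ∈ Q := by
  -- Rational times keep the exceptional set null; continuity and closedness of `Q` give the other
  -- times, approached from the right so that `t = 0` is included.
  have h1 : ∀ᵐ x ∂μ, ∀ q : ℚ, (q : ℝ) ∈ Ico 0 T → Ψ q x ∈ Q := by
    refine ae_all_iff.2 fun q => ?_
    by_cases hq : (q : ℝ) ∈ Ico 0 T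
    · filter_upwards [ae_of_ae_map (hm q hq) (Measure.support_mem_ae (μ := μ.map (Ψ q)))]
        with x hx _ using hs q hq hx
    · exact Filter.Eventually.of_forall fun x h => absurd h hq
  filter_upwards [h1, μ.support_mem_ae] with x hx hxS t ht
  have hcl : t ∈ closure (Ioo t T ∩ range ((↑) : ℚ → ℝ)) := by
    have := closure_mono
      (Rat.denseRange_cast.open_subset_closure_inter (isOpen_Ioo (a := t) (b := T)))
    rw [closure_closure, closure_Ioo ht.2.ne] at this
    exact this (left_mem_Icc.2 ht.2.le)
  have hsub : Ioo t T ∩ range ((↑) : ℚ → ℝ) ⊆ Ico 0 T := fun s hs =>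
    ⟨ht.1.trans hs.1.1.le, hs.1.2⟩
  rw [← hQ.closure_eq]
  refine ((hΨ x hxS t ht).mono hsub).mem_closure hcl ?_
  rintro _ ⟨hq, q, rfl⟩
  exact hx q (hsub ⟨hq, q, rfl⟩)

/-- Inserting the push-forward into the velocity closes each system of characteristics over `ρ₀`.
The two systems then satisfy the same equations with the same initial points. -/
lemma isWeakSolution_unique (hε : 0 < ε) (hg : DifferentiableOn ℝ g (Ici 0))
    (hg' : LocallyLipschitzOn (Ici 0) (derivWithin g (Ici 0)))
    (hK : ∀ x ∈ Hypercylinder n, ∀ y ∈ Hypercylinder n, K x y = g (intrinsicDist x y ^ 2))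
    {Q : Set (band n ε)} (hQ : IsCompact Q) {ρ₀ : ProbabilityMeasure (band n ε)}
    {ρ σ : Ico 0 T → ProbabilityMeasure (band n ε)}
    (hρQ : ∀ t, (ρ t : Measure (band n ε)).support ⊆ Q)
    (hσQ : ∀ t, (σ t : Measure (band n ε)).support ⊆ Q)
    (hρ : IsWeakSolution K ρ₀ ρ) (hσ : IsWeakSolution K ρ₀ σ) : ρ = σ := by
  obtain ⟨Ψ, hΨ, -, hΨm⟩ := hρ
  obtain ⟨Φ, hΦ, -, hΦm⟩ := hσ
  rw [isFlowMap_velocity_iff hε hg hg' hK hQ hρQ] at hΨ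
  rw [isFlowMap_velocity_iff hε hg hg' hK hQ hσQ] at hΦ
  have hF := locallyLipschitz_flatForce (n := n) hg'
  obtain ⟨R, hR⟩ := exists_norm_bandChart_le hQ
  obtain ⟨L, hL⟩ := hF.exists_lipschitzOnWith_closedBall (R + R)
  have hcont : ∀ {Ψ : ℝ → band n ε → band n ε} {x : band n ε},
      ContinuousOn (fun s => bandChart (Ψ s x)) (Ico 0 T) →
        ContinuousOn (fun s => Ψ s x) (Ico 0 T) := fun {Ψ x} h => by
    rw [continuousOn_iff_continuous_domRestrict] at h ⊢
    have := (continuous_bandPoint (n := n) (ε := ε)).comp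
      (h.subtype_mk fun s => bandChart_mem hε (Ψ s x))
    convert this using 1
    ext1 s
    exact (bandPoint_bandChart hε _).symm
  have hΨQ := ae_forall_mem_of_map_support_subset hQ.isClosed (T := T)
    (fun x hx => hcont fun s hs => ((hΨ x hx).2 ⟨s, hs⟩).continuousWithinAt)
    (fun t ht => (hΨm ⟨t, ht⟩).1) (fun t ht => (hΨm ⟨t, ht⟩).2 ▸ hρQ ⟨t, ht⟩)
  have hΦQ := ae_forall_mem_of_map_support_subset hQ.isClosed (T := T)
    (fun x hx => hcont fun s hs => ((hΦ x hx).2 ⟨s, hs⟩).continuousWithinAt)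
    (fun t ht => (hΦm ⟨t, ht⟩).1) (fun t ht => (hΦm ⟨t, ht⟩).2 ▸ hσQ ⟨t, ht⟩)
  -- The trajectories are compared on a set of full measure rather than on the support: the supports
  -- of `ρ t` and `σ t` place only almost every trajectory in `Q`. This is enough, because the
  -- velocities are integrals against `ρ₀`.
  set G : Set (band n ε) := {x | x ∈ (ρ₀ : Measure (band n ε)).support ∧
    (∀ t ∈ Ico 0 T, Ψ t x ∈ Q) ∧ ∀ t ∈ Ico 0 T, Φ t x ∈ Q} with hG
  have hGae : ∀ᵐ x ∂(ρ₀ : Measure (band n ε)), x ∈ G := by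
    filter_upwards [Measure.support_mem_ae, hΨQ, hΦQ] with x h1 h2 h3 using ⟨h1, h2, h3⟩
  have key : ∀ x : G, ∀ t ∈ Ico 0 T, bandChart (Ψ t x) = bandChart (Φ t x) := by
    intro x t ht
    refine eq_of_norm_velocity_sub_le (I := G) (L := 2 * L) (M := R + R) (by positivity)
      (α := fun x t => bandChart (Ψ t x)) (β := fun x t => bandChart (Φ t x))
      (α' := fun x t => ∫ y, flatForce g (bandChart (Ψ t x) - bandChart (Ψ t y))
        ∂(ρ₀ : Measure (band n ε)))
      (β' := fun x t => ∫ y, flatForce g (bandChart (Φ t x) - bandChart (Φ t y))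
        ∂(ρ₀ : Measure (band n ε))) (fun x s hs => ?_) (fun x s hs => ?_) (fun x => ?_)
      (fun x s hs => ?_) (fun s hs A hA x => ?_) x ht
    · rw [← integral_flatForce_map hg' (hΨm ⟨s, hs⟩).1, ← (hΨm ⟨s, hs⟩).2]
      exact (hΨ x x.2.1).2 ⟨s, hs⟩
    · rw [← integral_flatForce_map hg' (hΦm ⟨s, hs⟩).1, ← (hΦm ⟨s, hs⟩).2]
      exact (hΦ x x.2.1).2 ⟨s, hs⟩
    · simp only [(hΨ x x.2.1).1, (hΦ x x.2.1).1]
    · exact (norm_sub_le _ _).trans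
        (add_le_add (hR _ (x.2.2.1 s hs)) (hR _ (x.2.2.2 s hs)))
    · exact norm_integral_interaction_sub_le hF.continuous hL
        (continuous_bandChart.measurable.comp_aemeasurable (hΨm ⟨s, hs⟩).1)
        (continuous_bandChart.measurable.comp_aemeasurable (hΦm ⟨s, hs⟩).1)
        (hR _ (x.2.2.1 s hs)) (hR _ (x.2.2.2 s hs))
        (hGae.mono fun y hy => hR _ (hy.2.1 s hs)) (hGae.mono fun y hy => hR _ (hy.2.2 s hs))
        (hA x) (hGae.mono fun y hy => hA ⟨y, hy⟩)
  funext t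
  refine Subtype.ext ?_
  change (ρ t : Measure (band n ε)) = σ t
  rw [(hΨm t).2, (hΦm t).2]
  refine Measure.map_congr ?_
  filter_upwards [hGae] with x hx
  exact bandChart_injective hε (key ⟨x, hx⟩ t t.2)

end Band

end

/-! ### Existence -/

noncomputable section

open Metric NNReal

section Existence

variable {n : ℕ} {ε : ℝ} {K : Ambient n → Ambient n → ℝ} {g : ℝ → ℝ}

/-- A compact neighbourhood of a compact subset of the band, in flat coordinates. -/
lemma exists_compact_flat_neighbourhood (hε : 0 < ε) {S : Set (band n ε)} (hS : IsCompact S) :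
    ∃ r > 0, ∃ Q : Set (band n ε), IsCompact Q ∧
      ∀ x ∈ S, ∀ u, ‖u - bandChart x‖ ≤ r → ∃ q ∈ Q, bandChart q = u := by
  have hc : IsCompact (bandChart '' S) := hS.image continuous_bandChart
  -- A closed thickening of a compact set in finite dimension is compact, and a thin one stays in
  -- the open strip.
  obtain ⟨δ, hδ, hsub⟩ := hc.exists_cthickening_subset_open isOpen_flatBand
    (by rintro _ ⟨x, -, rfl⟩; exact bandChart_mem hε x)
  have : CompactSpace (cthickening δ (bandChart '' S)) :=
    isCompact_iff_compactSpace.1 hc.cthickening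
  refine ⟨δ, hδ, range fun u : cthickening δ (bandChart '' S) => bandPoint ⟨u, hsub u.2⟩,
    isCompact_range (continuous_bandPoint.comp
      (continuous_subtype_val.subtype_mk fun u : cthickening δ (bandChart '' S) => hsub u.2)),
    fun x hx u hu => ?_⟩
  have hmem : u ∈ cthickening δ (bandChart '' S) :=
    mem_cthickening_of_dist_le u _ δ _ (mem_image_of_mem _ hx) (by rwa [dist_eq_norm])
  exact ⟨_, ⟨⟨u, hmem⟩, rfl⟩, bandChart_bandPoint hε _⟩

/-- Local existence of a flow that solves the characteristic equations in flat coordinates and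
stays in a compact set. -/
lemma exists_characteristic_flow (hε : 0 < ε)
    (hg' : LocallyLipschitzOn (Ici 0) (derivWithin g (Ici 0)))
    {ρ₀ : Measure (band n ε)} [IsProbabilityMeasure ρ₀] (hS : IsCompact ρ₀.support) :
    ∃ T > 0, ∃ Q : Set (band n ε), IsCompact Q ∧ ρ₀.support ⊆ Q ∧
      ∃ Ψ : ℝ → band n ε → band n ε, (∀ t, AEMeasurable (Ψ t) ρ₀) ∧ ∀ x ∈ ρ₀.support,
        Ψ 0 x = x ∧ Continuous (fun t => Ψ t x) ∧ (∀ t, Ψ t x ∈ Q) ∧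
        ∀ t ∈ Ico 0 T, HasDerivWithinAt (fun s => bandChart (Ψ s x))
          (∫ y, flatForce g (bandChart (Ψ t x) - bandChart (Ψ t y)) ∂ρ₀) (Ico 0 T) t := by
  classical
  set S := ρ₀.support
  have hSm : MeasurableSet S := Measure.isClosed_support.measurableSet
  have hSae : S ∈ ae ρ₀ := Measure.support_mem_ae
  have hrestr : ρ₀.restrict S = ρ₀ := Measure.restrict_eq_self_of_ae_mem (s := S) hSae
  obtain ⟨r, hr, Q, hQ, hrQ⟩ := exists_compact_flat_neighbourhood hε hS
  have : CompactSpace S := isCompact_iff_compactSpace.1 hS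
  -- The support has full measure, so `ρ₀` becomes a probability measure on the compact space `S`.
  have hμ : IsProbabilityMeasure (ρ₀.comap ((↑) : S → band n ε)) := ⟨by
    rw [comap_subtype_coe_apply hSm, image_univ, Subtype.range_coe]
    exact (prob_compl_eq_zero_iff hSm).1 hSae⟩
  obtain ⟨T, hT, Φ, hΦ0, hΦc, hΦr, hΦd⟩ := exists_lagrangian_flow
    (locallyLipschitz_flatForce (n := n) hg')
    (ContinuousMap.mk (fun x : S => bandChart x.1)
      (continuous_bandChart.comp continuous_subtype_val)) hr
    (ρ₀.comap ((↑) : S → band n ε))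
  have hq : ∀ t (x : S), ∃ q ∈ Q, bandChart q = Φ t x := fun t x => hrQ x x.2 _ (hΦr t x)
  have hΦmem : ∀ t (x : S), Φ t x ∈ flatBand n ε := fun t x => by
    obtain ⟨q, -, h⟩ := hq t x
    exact h ▸ bandChart_mem hε q
  -- Off the support, a null set, the value is immaterial.
  set Ψ : ℝ → band n ε → band n ε := fun t x =>
    if hx : x ∈ S then bandPoint ⟨Φ t ⟨x, hx⟩, hΦmem t ⟨x, hx⟩⟩ else x
  have hΨS : ∀ t (x : S), Ψ t x = bandPoint ⟨Φ t x, hΦmem t x⟩ := fun t x => dif_pos x.2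
  have hΨc : ∀ t (x : S), bandChart (Ψ t x) = Φ t x := fun t x => by
    rw [hΨS, bandChart_bandPoint hε]
  refine ⟨T, hT, Q, hQ, fun x hx => ?_, Ψ, fun t => ?_, fun x hx => ⟨?_, ?_, fun t => ?_,
    fun t ht => ?_⟩⟩
  · obtain ⟨q, hqQ, h⟩ := hrQ x hx (bandChart x) (by simpa using hr.le)
    exact bandChart_injective hε h ▸ hqQ
  · have hc : ContinuousOn (Ψ t) S := by
      rw [continuousOn_iff_continuous_domRestrict]
      exact (continuous_bandPoint.comp ((Φ t).continuous.subtype_mk (hΦmem t))).congr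
        fun x => (hΨS t x).symm
    have := hc.aemeasurable (μ := ρ₀) hSm
    rwa [hrestr] at this
  · refine bandChart_injective hε ((hΨc 0 ⟨x, hx⟩).trans ?_)
    rw [hΦ0]
    rfl
  · have hc : Continuous fun t => Φ t ⟨x, hx⟩ := 
      (ContinuousMap.evalCLM ℝ (⟨x, hx⟩ : S)).continuous.comp hΦc
    exact (continuous_bandPoint.comp (hc.subtype_mk fun t => hΦmem t ⟨x, hx⟩)).congr
      fun t => (hΨS t ⟨x, hx⟩).symm
  · obtain ⟨q, hqQ, h⟩ := hq t ⟨x, hx⟩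
    exact bandChart_injective hε (h.trans (hΨc t ⟨x, hx⟩).symm) ▸ hqQ
  · have h := hΦd ⟨x, hx⟩ t ht
    simp only [← hΨc] at h
    rwa [integral_subtype_comap hSm
      (fun y => flatForce g (bandChart (Ψ t x) - bandChart (Ψ t y))),
      hrestr] at h

/-- Transporting a measure along almost surely continuous curves is narrowly continuous. -/
lemma continuous_map_probabilityMeasure {X : Type*} [TopologicalSpace X] [MeasurableSpace X]
    [OpensMeasurableSpace X] {μ : ProbabilityMeasure X}
    {Ψ : ℝ → X → X} (hm : ∀ t, AEMeasurable (Ψ t) (μ : Measure X))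
    (hc : ∀ᵐ x ∂(μ : Measure X), Continuous fun t => Ψ t x) :
    Continuous fun t => μ.map (hm t) := by
  refine continuous_iff_continuousAt.2 fun t => ?_
  refine ProbabilityMeasure.tendsto_iff_forall_integral_tendsto.2 fun f => ?_
  simp only [ProbabilityMeasure.toMeasure_map]
  have e : ∀ s, ∫ x, f x ∂((μ : Measure X).map (Ψ s)) =
      ∫ x, f (Ψ s x) ∂(μ : Measure X) := fun s =>
    integral_map (hm s) f.continuous.measurable.aestronglyMeasurable
  simp only [e]
  refine tendsto_integral_filter_of_dominated_convergence (fun _ => ‖f‖)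
    (Filter.Eventually.of_forall fun s =>
      (f.continuous.measurable.comp_aemeasurable (hm s)).aestronglyMeasurable)
    (Filter.Eventually.of_forall fun s => Filter.Eventually.of_forall fun x =>
      f.norm_coe_le_norm _) (integrable_const _) ?_
  filter_upwards [hc] with x hx using (f.continuous.comp hx).tendsto t

end Existence

end

theorem mainTheorem8 (n : ℕ) (ε : ℝ) (hε : 0 < ε) (hεπ : ε < Real.pi)
    (K : Ambient n → Ambient n → ℝ) (hK : HypothesisH K)
    (ρ₀ : ProbabilityMeasure (band n ε))
    (hρ₀ : IsCompact (ρ₀ : Measure (band n ε)).support) :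
    ∃ (T : ℝ) (hT : 0 < T) (Q : Set (band n ε)),
      IsCompact Q ∧ (ρ₀ : Measure (band n ε)).support ⊆ Q ∧
      ∃! ρ : C(Ico 0 T, ProbOn Q),
        (ρ ⟨0, left_mem_Ico.2 hT⟩ : ProbabilityMeasure (band n ε)) = ρ₀ ∧
        IsWeakSolution K ρ₀ (fun t => (ρ t : ProbabilityMeasure (band n ε))) := by
  obtain ⟨g, hg, hg', hK⟩ := hK
  obtain ⟨T, hT, Q, hQ, hSQ, Ψ, hm, hΨ⟩ := exists_characteristic_flow hε hg' hρ₀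
  have hae : ∀ᵐ x ∂(ρ₀ : Measure (band n ε)), x ∈ (ρ₀ : Measure (band n ε)).support :=
    Measure.support_mem_ae
  have hsupp : ∀ t, ((ρ₀ : Measure (band n ε)).map (Ψ t)).support ⊆ Q := fun t =>
    Measure.support_subset_of_isClosed hQ.isClosed
      ((ae_map_iff (hm t) hQ.measurableSet).2 (hae.mono fun x hx => (hΨ x hx).2.2.1 t))
  set ρ : C(Ico 0 T, ProbOn Q) :=
    ⟨fun t => ⟨ρ₀.map (hm t), hsupp t⟩, ((continuous_map_probabilityMeasure hm
        (hae.mono fun x hx => (hΨ x hx).2.1)).comp continuous_subtype_val).subtype_mk _⟩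
  have hflow : IsFlowMap (velocity K fun t => (ρ t : ProbabilityMeasure (band n ε)))
      (ρ₀ : Measure (band n ε)).support Ψ := by
    rw [isFlowMap_velocity_iff hε hg hg' hK hQ fun t => (ρ t).2]
    refine fun x hx => ⟨(hΨ x hx).1, fun t => ?_⟩
    -- As `ρ t` is the push-forward by `Ψ t`, the characteristic equation is the flow equation of
    -- `ρ`'s own velocity.
    have h := (hΨ x hx).2.2.2 t t.2
    rwa [← integral_flatForce_map hg' (hm t)] at h
  refine ⟨T, hT, Q, hQ, hSQ, ρ, ⟨Subtype.ext ?_, Ψ, hflow, fun Φ hΦ x hx t ht =>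
    flowMap_unique hε hg hg' hK hQ (fun t => (ρ t).2) hflow hΦ hx ht,
    fun t => ⟨hm t, rfl⟩⟩, fun σ hσ => ?_⟩
  · change (ρ₀ : Measure (band n ε)).map (Ψ 0) = ρ₀
    rw [Measure.map_congr (hae.mono fun x hx => (hΨ x hx).1 : Ψ 0 =ᵐ[_] id), Measure.map_id]
  · refine ContinuousMap.ext fun t => Subtype.ext (congrFun
      (isWeakSolution_unique hε hg hg' hK hQ (fun t => (σ t).2) (fun t => (ρ t).2) hσ.2
        ⟨Ψ, hflow, fun Φ hΦ x hx t ht => ?_, fun t => ⟨hm t, rfl⟩⟩) t)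
    exact flowMap_unique hε hg hg' hK hQ (fun t => (ρ t).2) hflow hΦ hx ht
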